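/- Let $\Phi$ be a finite reduced (not necessarily crystallographic) root system in a Euclidean space, with simple roots $\Delta$ and positive roots $\Phi^+$. Let $W$ be the finite Coxeter group generated by the reflections orthogonal to the roots, and let $S=\{s_\alpha:\alpha\in\Delta\}$ be the set of simple reflections. For $w\in W$, let $\ell(w)$ be the minimal number of factors in an expression of $w$ as a product of elements of $S$; an expression with $\ell(w)$ factors is called reduced. The weak order on $W$ is defined by $\sigma\le\omega$ if and only if $\sigma\tau=\omega$ for some $\tau\in W$ with $\ell(\sigma)+\ell(\tau)=\ell(\omega)$. Let $Q=(q_1,\dots,q_m)$ be a word on $S$ and let $\omega\in W$. The subword complex $\mathcal{SC}(Q,\omega)$ is the simplicial complex on $[m]=\{1,\dots,m\}$ whose facets are the sets $I\subseteq[m]$ such that the subword of $Q$ at the positions of $[m]\setminus I$ is a reduced expression of $\omega$. For a facet $I$ and $k\in[m]$, put $\mathrm{r}(I,k)=\Big(\prod_{i<k,\ i\notin I} q_i\Big)(\alpha_{q_k})$, where the product is taken in increasing order of $i$ and $\alpha_s\in\Delta$ denotes the simple root of $s\in S$. Put $\mathrm{R}(I)=\{\mathrm{r}(I,i): i\in I\}$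 and $\mathcal{L}(I)=\{\pi\in W:\mathrm{R}(I)\subseteq\pi(\Phi^+)\}$, and let $\mathcal{L}(Q,\omega)=\bigcup_I\mathcal{L}(I)$, the union being over all facets $I$ of $\mathcal{SC}(Q,\omega)$. Theorem. Suppose that $\mathcal{SC}(Q,\omega)$ is non-empty (that is, it has at least one facet). Then: (1) for every facet $I$, the set $\mathcal{L}(I)$ is order convex in the weak order: if $\sigma\le\tau\le\rho$ and $\sigma,\rho\in\mathcal{L}(I)$, then $\tau\in\mathcal{L}(I)$; (2) $\mathcal{L}(Q,\omega)$ is a lower set of the weak order: if $\sigma\le\tau$ and $\tau\in\mathcal{L}(Q,\omega)$, then $\sigma\in\mathcal{L}(Q,\omega)$; (3) the weak order interval $[e,\omega]$, where $e$ is the identity of $W$, is contained in $\mathcal{L}(Q,\omega)$; (4) if $I\ne J$ are facets, then $\mathcal{L}(I)\cap\mathcal{L}(J)=\varnothing$. -/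

import Mathlib

open scoped NNReal

namespace SubwordCplx

/-- A finite (reduced, not necessarily crystallographic) root system `Φ` in a Euclidean space `V`,
together with a choice of simple roots `Δ ⊆ Φ`: the set `Δ` is linearly independent and every root
is a linear combination of simple roots with coefficients either all `≥ 0` or all `≤ 0`. -/
structure BasedRootSystem (V : Type*) [NormedAddCommGroup V] [InnerProductSpace ℝ V] where
  /-- the set `Φ` of roots -/
  roots : Set V
  finite_roots : roots.Finite
  ne_zero : ∀ α ∈ roots, α ≠ 0
  /-- the only multiples of a root `α` that are roots are `α` and `-α` -/
  reduced : ∀ α ∈ roots, ∀ c : ℝ, c • α ∈ roots → c = 1 ∨ c = -1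
  /-- the reflection orthogonal to a root preserves `Φ` -/
  reflection_mem : ∀ α ∈ roots, ∀ β ∈ roots, (ℝ ∙ α)ᗮ.reflection β ∈ roots
  /-- the set `Δ` of simple roots -/
  simple : Set V
  simple_subset : simple ⊆ roots
  linearIndepOn_simple : LinearIndepOn ℝ id simple
  nonneg_or_nonpos : ∀ α ∈ roots,
    α ∈ Submodule.span ℝ≥0 simple ∨ -α ∈ Submodule.span ℝ≥0 simple

variable {V : Type*} [NormedAddCommGroup V] [InnerProductSpace ℝ V]

namespace BasedRootSystem

variable (R : BasedRootSystem V)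

/-- The positive roots `Φ⁺`: the roots that are nonnegative combinations of simple roots. -/
def posRoots : Set V := {α | α ∈ R.roots ∧ α ∈ Submodule.span ℝ≥0 R.simple}

/-- The finite Coxeter group `W`, generated by the reflections orthogonal to all roots. -/
def coxeterGroup : Subgroup (V ≃ₗᵢ[ℝ] V) :=
  Subgroup.closure {s | ∃ α ∈ R.roots, s = (ℝ ∙ α)ᗮ.reflection}

/-- The simple reflection `s_α ∈ W` of a simple root `α`. Distinct simple roots have distinct
reflections, so a letter `s ∈ S` of a word is encoded by its simple root `α_s ∈ Δ`. -/
noncomputable def simpleReflection (α : R.simple) : R.coxeterGroup :=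
  ⟨(ℝ ∙ (α : V))ᗮ.reflection,
    Subgroup.subset_closure ⟨(α : V), R.simple_subset α.2, rfl⟩⟩

/-- The product in `W` of a word in the simple reflections. -/
noncomputable def wordProd (l : List R.simple) : R.coxeterGroup :=
  (l.map R.simpleReflection).prod

/-- The length `ℓ(w)`: the minimal length of a word in the simple reflections with product `w`. -/
noncomputable def length (w : R.coxeterGroup) : ℕ :=
  sInf {n | ∃ l : List R.simple, l.length = n ∧ R.wordProd l = w}

/-- The word `l` is a reduced expression of `w`. -/
def IsReducedExpr (l : List R.simple) (w : R.coxeterGroup) : Prop :=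
  R.wordProd l = w ∧ l.length = R.length w

/-- The weak order on `W`: `σ ≤ ω` iff `σ τ = ω` for some `τ` with `ℓ(σ) + ℓ(τ) = ℓ(ω)`. -/
def WeakLE (σ ω : R.coxeterGroup) : Prop :=
  ∃ τ : R.coxeterGroup, σ * τ = ω ∧ R.length σ + R.length τ = R.length ω

/-- The interval `[σ, ω]` of the weak order. -/
def weakInterval (σ ω : R.coxeterGroup) : Set R.coxeterGroup :=
  {π | R.WeakLE σ π ∧ R.WeakLE π ω}

/-- Lower sets of the weak order. -/
def IsWeakLowerSet (A : Set R.coxeterGroup) : Prop :=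
  ∀ σ τ, R.WeakLE σ τ → τ ∈ A → σ ∈ A

/-- Order convex subsets of the weak order. -/
def IsWeakOrderConvex (A : Set R.coxeterGroup) : Prop :=
  ∀ σ τ ρ, R.WeakLE σ τ → R.WeakLE τ ρ → σ ∈ A → ρ ∈ A → τ ∈ A

variable {m : ℕ}

/-- The subword `Q_J` of `Q` formed by the letters at the positions in `J`, in natural order. -/
def subword (Q : Fin m → R.simple) (J : Finset (Fin m)) : List R.simple :=
  ((List.finRange m).filter (fun i => i ∈ J)).map Q

/-- The facets of the subword complex of `Q` and `ω`: the sets of positions whose complement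
forms a reduced expression of `ω`. -/
def facets (Q : Fin m → R.simple) (ω : R.coxeterGroup) : Set (Finset (Fin m)) :=
  {I | R.IsReducedExpr (R.subword Q Iᶜ) ω}

/-- The subword complex of `Q` and `ω`, as the set of its faces (the empty face included). -/
def subwordComplex (Q : Fin m → R.simple) (ω : R.coxeterGroup) : Set (Finset (Fin m)) :=
  {F | ∃ I ∈ R.facets Q ω, F ⊆ I}

/-- The root function of `I`: the product of the letters at the positions `i < k`, `i ∉ I`,
applied to the simple root of the letter at position `k`. -/
noncomputable def rootFunction (Q : Fin m → R.simple) (I : Finset (Fin m)) (k : Fin m) : V :=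
  (R.wordProd (R.subword Q (Finset.Iio k \ I)) : V ≃ₗᵢ[ℝ] V) (Q k : V)

/-- The root configuration of `I`. -/
def rootConfiguration (Q : Fin m → R.simple) (I : Finset (Fin m)) : Set V :=
  {β | ∃ i ∈ I, R.rootFunction Q I i = β}

/-- The linear extensions of `I`: the `π ∈ W` whose image `π(Φ⁺)` contains the root
configuration of `I`. -/
def linearExtensions (Q : Fin m → R.simple) (I : Finset (Fin m)) : Set R.coxeterGroup :=
  {π | R.rootConfiguration Q I ⊆ (π : V ≃ₗᵢ[ℝ] V) '' R.posRoots}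

/-- The linear extensions of all facets of the subword complex of `Q` and `ω`. -/
def allLinearExtensions (Q : Fin m → R.simple) (ω : R.coxeterGroup) : Set R.coxeterGroup :=
  ⋃ I ∈ R.facets Q ω, R.linearExtensions Q I

end BasedRootSystem

end SubwordCplx

namespace SubwordCplx
namespace BasedRootSystem

variable {V : Type*} [NormedAddCommGroup V] [InnerProductSpace ℝ V] (R : BasedRootSystem V)

/-! ### Positive and negative roots -/

/-! Facets are encoded by their complements `C`, the positions of a reduced subword for `ω`. `pre Q
C n` is the prefix product and `rootAt Q C k` the root at `k`. A used position crosses its root.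
`Compatible Q C π` says that every root at an omitted position lies in `π(Φ⁺)`.

Going up in the weak order only adds inversions (`WeakLE.neg_act_inv_mem`). So `β ∈ π(Φ⁺)` is a
downward closed condition on `π` if `β` is positive, and an upward closed one if `β` is negative.
Intersecting such conditions gives (1).

For (2), a cover `π s_α < π` replaces the single root `πα` of `π(Φ⁺)` by `β = -πα ∈ Φ⁺`. If no
omitted position has root `-β`, then `C` stays compatible. Otherwise let `i` be the last such
position. A negative root there means that `β` was crossed at some used `j < i`, and exchanging `j`
with `i` keeps the word reduced and reflects only the roots in `(j, i]`; the result is compatible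
with `π s_α` (`exists_compatible_descent`).

For (3), by (2) it suffices to treat `ω` itself: a reduced subword with minimal sum of positions is
compatible with `ω` (`exists_compatible_self`).

For (4), induct on `ℓ(π)`. The descent of (2) can be undone, since `i` is the unique crossing of `β`
in the new subword and `j` the first omitted position with root `β`. For `π = 1`, reading from right
to left determines `C` (`eq_of_compatible_one`). -/

theorem reflection_apply_eq (α v : V) :
    (ℝ ∙ α)ᗮ.reflection v = v - (2 * inner ℝ α v / inner ℝ α α) • α := by
  rw [Submodule.reflection_orthogonal_apply, Submodule.reflection_singleton_apply,
    real_inner_self_eq_norm_sq, two_nsmul, ← add_smul]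
  simp only [RCLike.ofReal_real_eq_id, id_eq, neg_sub]
  congr 2
  ring

/-- A function on the simple roots extends to a linear functional. -/
theorem exists_functional (g : V → ℝ) : ∃ φ : V →ₗ[ℝ] ℝ, ∀ α ∈ R.simple, φ α = g α := by
  let b := Module.Basis.extend R.linearIndepOn_simple
  refine ⟨b.constr ℝ (fun i => g i), fun α hα => ?_⟩
  have h := b.constr_basis ℝ (fun i => g i)
    ⟨α, R.linearIndepOn_simple.subset_extend _ hα⟩
  rwa [Module.Basis.extend_apply_self] at h

theorem functional_nonneg {φ : V →ₗ[ℝ] ℝ} (hφ : ∀ α ∈ R.simple, 0 ≤ φ α) {v : V}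
    (hv : v ∈ Submodule.span ℝ≥0 R.simple) : 0 ≤ φ v := by
  induction hv using Submodule.span_induction with
  | mem x hx => exact hφ x hx
  | zero => simp
  | add x y _ _ hx hy => rw [map_add]; exact add_nonneg hx hy
  | smul a x _ hx =>
    rw [NNReal.smul_def, map_smul]
    exact mul_nonneg a.2 hx

/-- The sum of the coefficients on simple roots. It separates `Φ⁺` from `-Φ⁺` and later measures
descent among positive roots. -/
theorem exists_height : ∃ φ : V →ₗ[ℝ] ℝ, (∀ α ∈ R.simple, φ α = 1) ∧
    ∀ v ∈ Submodule.span ℝ≥0 R.simple, v ≠ 0 → 0 < φ v := by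
  obtain ⟨φ, hφ⟩ := R.exists_functional (fun _ => 1)
  refine ⟨φ, hφ, fun v hv => ?_⟩
  induction hv using Submodule.span_induction with
  | mem x hx => intro _; rw [hφ x hx]; exact one_pos
  | zero => simp
  | add x y _ _ hx hy =>
    intro h
    by_cases hx0 : x = 0
    · subst hx0; simpa using hy (by simpa using h)
    · by_cases hy0 : y = 0
      · subst hy0; simpa using hx hx0
      · rw [map_add]; exact add_pos (hx hx0) (hy hy0)
  | smul a x _ hx =>
    intro h
    have ha : a ≠ 0 := by rintro rfl; simp at h
    have hx0 : x ≠ 0 := by rintro rfl; simp at h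
    rw [NNReal.smul_def, map_smul]
    exact mul_pos (NNReal.coe_pos.2 (pos_iff_ne_zero.2 ha)) (hx hx0)

theorem simple_mem_posRoots {α : V} (hα : α ∈ R.simple) : α ∈ R.posRoots :=
  ⟨R.simple_subset hα, Submodule.subset_span hα⟩

theorem neg_mem_roots {α : V} (hα : α ∈ R.roots) : -α ∈ R.roots := by
  have := R.reflection_mem α hα α hα
  rwa [Submodule.reflection_orthogonalComplement_singleton_eq_neg] at this

theorem mem_posRoots_or_neg {β : V} (hβ : β ∈ R.roots) : β ∈ R.posRoots ∨ -β ∈ R.posRoots :=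
  (R.nonneg_or_nonpos β hβ).imp (fun h => ⟨hβ, h⟩) (fun h => ⟨R.neg_mem_roots hβ, h⟩)

theorem neg_notMem_posRoots {β : V} (hβ : β ∈ R.posRoots) : -β ∉ R.posRoots := by
  intro h
  obtain ⟨φ, -, hφ⟩ := R.exists_height
  have h1 := hφ β hβ.2 (R.ne_zero β hβ.1)
  have h2 := hφ _ h.2 (R.ne_zero _ h.1)
  rw [map_neg] at h2
  linarith

/-- A nonnegative combination of simple roots has a positive coefficient away from `α`, unless it
is a multiple of `α`. -/
theorem exists_separating_functional (α : V) {v : V} (hv : v ∈ Submodule.span ℝ≥0 R.simple) :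
    (∃ c : ℝ, v = c • α) ∨ ∃ φ : V →ₗ[ℝ] ℝ,
      (∀ γ ∈ R.simple, 0 ≤ φ γ) ∧ (α ∈ R.simple → φ α = 0) ∧ 0 < φ v := by
  classical
  -- The sum of all coefficients except that of `α`.
  obtain ⟨φ, hφ⟩ := R.exists_functional (fun γ => if γ = α then 0 else 1)
  have hnn : ∀ γ ∈ R.simple, 0 ≤ φ γ := by
    intro γ hγ
    rw [hφ γ hγ]
    split_ifs <;> norm_num
  have key : (∃ c : ℝ, v = c • α) ∨ 0 < φ v := by
    induction hv using Submodule.span_induction with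
    | mem x hx =>
      by_cases h : x = α
      · exact Or.inl ⟨1, by simp [h]⟩
      · right
        rw [hφ x hx, if_neg h]
        exact one_pos
    | zero => exact Or.inl ⟨0, by simp⟩
    | add x y hx hy ihx ihy =>
      have h1 := R.functional_nonneg hnn hx
      have h2 := R.functional_nonneg hnn hy
      rw [map_add]
      rcases ihx with ⟨c, hc⟩ | ihx
      · rcases ihy with ⟨d, hd⟩ | ihy
        · exact Or.inl ⟨c + d, by rw [hc, hd, add_smul]⟩
        · right; linarith
      · right; linarith
    | smul a x hx ihx =>
      by_cases ha : a = 0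
      · exact Or.inl ⟨0, by simp [ha]⟩
      rcases ihx with ⟨c, hc⟩ | ihx
      · exact Or.inl ⟨a * c, by rw [hc, NNReal.smul_def, smul_smul]⟩
      · right
        rw [NNReal.smul_def, map_smul]
        exact mul_pos (NNReal.coe_pos.2 (pos_iff_ne_zero.2 ha)) ihx
  exact key.imp_right fun h => ⟨φ, hnn, fun hα => by rw [hφ α hα, if_pos rfl], h⟩

/-- A simple reflection permutes the positive roots other than its simple root. -/
theorem reflection_mem_posRoots {α β : V} (hα : α ∈ R.simple) (hβ : β ∈ R.posRoots)
    (hne : β ≠ α) : (ℝ ∙ α)ᗮ.reflection β ∈ R.posRoots := by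
  have hr := R.reflection_mem α (R.simple_subset hα) β hβ.1
  rcases R.mem_posRoots_or_neg hr with h | h
  · exact h
  exfalso
  rcases R.exists_separating_functional α hβ.2 with ⟨c, hc⟩ | ⟨φ, h0, h1, h2⟩
  · have hmem := hβ.1
    rw [hc] at hmem
    rcases R.reduced α (R.simple_subset hα) c hmem with rfl | rfl
    · exact hne (by simpa using hc)
    · rw [neg_one_smul] at hc
      exact R.neg_notMem_posRoots (R.simple_mem_posRoots hα) (hc ▸ hβ)
  -- The reflection changes only the coefficient of `α`, which `φ` ignores, so the image of `β`
  -- keeps a positive value.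
  · have h3 := R.functional_nonneg h0 h.2
    rw [reflection_apply_eq, map_neg, map_sub, map_smul, h1 hα, smul_zero, sub_zero] at h3
    linarith

/-- Otherwise pairing with `β`, itself a nonnegative combination of simple roots, would give `⟨β, β⟩
≤ 0`. -/
theorem exists_inner_pos {β : V} (hβ : β ∈ R.posRoots) : ∃ α ∈ R.simple, 0 < inner ℝ α β := by
  by_contra! h
  have h1 := R.functional_nonneg (φ := -(innerₗ V β)) (fun α hα => by
    have := h α hα
    rw [real_inner_comm] at this
    simpa using this) hβ.2
  have h2 := real_inner_self_pos.2 (R.ne_zero β hβ.1)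
  simp only [LinearMap.neg_apply, innerₗ_apply_apply] at h1
  linarith

/-! ### The action of the Coxeter group -/

/-- The action of the Coxeter group on the ambient space. -/
def act (w : R.coxeterGroup) (v : V) : V := (w : V ≃ₗᵢ[ℝ] V) v

@[simp] theorem act_one (v : V) : R.act 1 v = v := rfl

@[simp] theorem act_mul (u w : R.coxeterGroup) (v : V) :
    R.act (u * w) v = R.act u (R.act w v) := rfl

@[simp] theorem act_neg (w : R.coxeterGroup) (v : V) : R.act w (-v) = -R.act w v :=
  map_neg (w : V ≃ₗᵢ[ℝ] V) v

@[simp] theorem act_inv_act (w : R.coxeterGroup) (v : V) : R.act w⁻¹ (R.act w v) = v := by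
  rw [← act_mul, inv_mul_cancel, act_one]

@[simp] theorem act_act_inv (w : R.coxeterGroup) (v : V) : R.act w (R.act w⁻¹ v) = v := by
  rw [← act_mul, mul_inv_cancel, act_one]

theorem eq_act_iff {w : R.coxeterGroup} {u v : V} : R.act w⁻¹ u = v ↔ u = R.act w v :=
  ⟨fun h => by rw [← h, act_act_inv], fun h => by rw [h, act_inv_act]⟩

theorem ext_act {u w : R.coxeterGroup} (h : ∀ v, R.act u v = R.act w v) : u = w :=
  Subtype.ext (LinearIsometryEquiv.ext h)

theorem act_mem_roots (w : R.coxeterGroup) {β : V} (hβ : β ∈ R.roots) : R.act w β ∈ R.roots := by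
  obtain ⟨w, hw⟩ := w
  -- An equivalence, so that the induction passes to inverses.
  suffices h : ∀ β, w β ∈ R.roots ↔ β ∈ R.roots from (h β).2 hβ
  clear hβ β
  induction hw using Subgroup.closure_induction with
  | mem s hs =>
    obtain ⟨α, hα, rfl⟩ := hs
    refine fun β => ⟨fun h => ?_, R.reflection_mem α hα β⟩
    simpa using R.reflection_mem α hα _ h
  | one => exact fun β => Iff.rfl
  | mul x y _ _ hx hy => exact fun β => (hx (y β)).trans (hy β)
  | inv x _ hx =>
    intro β
    rw [← hx (x⁻¹ β), LinearIsometryEquiv.inv_def, LinearIsometryEquiv.apply_symm_apply]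

theorem act_simpleReflection (α : R.simple) (v : V) :
    R.act (R.simpleReflection α) v = v - (2 * inner ℝ (α : V) v / inner ℝ (α : V) α) • (α : V) :=
  reflection_apply_eq _ _

@[simp] theorem act_simpleReflection_self (α : R.simple) :
    R.act (R.simpleReflection α) α = -α :=
  Submodule.reflection_orthogonalComplement_singleton_eq_neg _

theorem act_simpleReflection_mem (α : R.simple) {β : V} (hβ : β ∈ R.posRoots) (hne : β ≠ α) :
    R.act (R.simpleReflection α) β ∈ R.posRoots :=
  R.reflection_mem_posRoots α.2 hβ hne

@[simp] theorem simpleReflection_mul_self (α : R.simple) :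
    R.simpleReflection α * R.simpleReflection α = 1 := by
  refine R.ext_act fun v => ?_
  change (ℝ ∙ (α : V))ᗮ.reflection ((ℝ ∙ (α : V))ᗮ.reflection v) = v
  exact Submodule.reflection_reflection _ _

@[simp] theorem simpleReflection_inv (α : R.simple) :
    (R.simpleReflection α)⁻¹ = R.simpleReflection α :=
  inv_eq_of_mul_eq_one_left (R.simpleReflection_mul_self α)

@[simp] theorem mul_simpleReflection_cancel (w : R.coxeterGroup) (α : R.simple) :
    w * R.simpleReflection α * R.simpleReflection α = w := by
  rw [mul_assoc, simpleReflection_mul_self, mul_one]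

/-- The conjugate `w s_α w⁻¹` acts as the reflection orthogonal to `w α`. -/
theorem act_conj (w : R.coxeterGroup) (α : R.simple) (v : V) :
    R.act (w * R.simpleReflection α * w⁻¹) v = (ℝ ∙ R.act w α)ᗮ.reflection v := by
  have hin : ∀ x y : V, inner ℝ (R.act w x) (R.act w y) = inner ℝ x y :=
    fun x y => LinearIsometryEquiv.inner_map_map _ x y
  have hlin : ∀ (c : ℝ) (x y : V), R.act w (x - c • y) = R.act w x - c • R.act w y := by
    intro c x y
    simp [act]
  rw [reflection_apply_eq, act_mul, act_mul, act_simpleReflection, hlin, hin, act_act_inv,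
    ← hin _ (R.act w⁻¹ v), act_act_inv]

/-- Both sides are reflections orthogonal to the same line. -/
theorem conj_eq_conj {u w : R.coxeterGroup} {α γ : R.simple}
    (h : R.act u α = R.act w γ ∨ R.act u α = -R.act w γ) :
    u * R.simpleReflection α * u⁻¹ = w * R.simpleReflection γ * w⁻¹ := by
  refine R.ext_act fun v => ?_
  rw [act_conj, act_conj]
  rcases h with h | h <;> rw [h]
  rw [reflection_apply_eq, reflection_apply_eq]
  simp [neg_div]

/-! ### Words and length -/

@[simp] theorem wordProd_nil : R.wordProd [] = 1 := rfl

@[simp] theorem wordProd_cons (α : R.simple) (l : List R.simple) :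
    R.wordProd (α :: l) = R.simpleReflection α * R.wordProd l := by
  simp [wordProd]

theorem wordProd_append (l l' : List R.simple) :
    R.wordProd (l ++ l') = R.wordProd l * R.wordProd l' := by
  simp [wordProd]

theorem wordProd_concat (l : List R.simple) (α : R.simple) :
    R.wordProd (l ++ [α]) = R.wordProd l * R.simpleReflection α := by
  simp [wordProd]

theorem wordProd_reverse (l : List R.simple) : R.wordProd l.reverse = (R.wordProd l)⁻¹ := by
  induction l with
  | nil => simp
  | cons α l ih => rw [List.reverse_cons, wordProd_concat, ih, wordProd_cons, mul_inv_rev,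
      simpleReflection_inv]

/-- Every positive root is conjugate to a simple root under simple reflections. -/
theorem exists_wordProd_act_eq {β : V} (hβ : β ∈ R.posRoots) :
    ∃ (l : List R.simple) (α : R.simple), R.act (R.wordProd l) α = β := by
  by_contra hbad
  obtain ⟨φ, hφ, hφpos⟩ := R.exists_height
  let B : Set V := {β | β ∈ R.posRoots ∧
    ¬∃ (l : List R.simple) (α : R.simple), R.act (R.wordProd l) α = β}
  have hfin : B.Finite := R.finite_roots.subset fun x hx => hx.1.1
  -- A counterexample of least height: reflecting it in a simple root with positive inner product
  -- lowers the height and keeps it positive.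
  obtain ⟨γ, ⟨hγ, hγbad⟩, hmin⟩ := Set.exists_min_image B φ hfin ⟨β, hβ, hbad⟩
  obtain ⟨α, hα, hpos⟩ := R.exists_inner_pos hγ
  have hne : γ ≠ α := by
    rintro rfl
    exact hγbad ⟨[], ⟨γ, hα⟩, rfl⟩
  have hmem := R.act_simpleReflection_mem ⟨α, hα⟩ hγ hne
  have hlt : φ (R.act (R.simpleReflection ⟨α, hα⟩) γ) < φ γ := by
    rw [act_simpleReflection, map_sub, map_smul, hφ α hα, smul_eq_mul, mul_one]
    have h2 := real_inner_self_pos.2 (R.ne_zero α (R.simple_subset hα))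
    have : 0 < 2 * inner ℝ α γ / inner ℝ α α := by positivity
    linarith
  have hgood : R.act (R.simpleReflection ⟨α, hα⟩) γ ∉ B := fun h => (hmin _ h).not_gt hlt
  obtain ⟨l, δ, hl⟩ : ∃ (l : List R.simple) (δ : R.simple),
      R.act (R.wordProd l) δ = R.act (R.simpleReflection ⟨α, hα⟩) γ := by
    by_contra h
    exact hgood ⟨hmem, h⟩
  refine hγbad ⟨⟨α, hα⟩ :: l, δ, ?_⟩
  rw [wordProd_cons, act_mul, hl, ← act_mul, simpleReflection_mul_self, act_one]

/-- The simple reflections generate the Coxeter group. -/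
theorem exists_wordProd_eq (w : R.coxeterGroup) : ∃ l : List R.simple, R.wordProd l = w := by
  obtain ⟨w, hw⟩ := w
  induction hw using Subgroup.closure_induction with
  | mem s hs =>
    obtain ⟨β, hβ, rfl⟩ := hs
    obtain ⟨l, α, h⟩ : ∃ (l : List R.simple) (α : R.simple),
        R.act (R.wordProd l) α = β ∨ R.act (R.wordProd l) α = -β := by
      rcases R.mem_posRoots_or_neg hβ with h | h
      · obtain ⟨l, α, h⟩ := R.exists_wordProd_act_eq h
        exact ⟨l, α, Or.inl h⟩
      · obtain ⟨l, α, h⟩ := R.exists_wordProd_act_eq h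
        exact ⟨l, α, Or.inr h⟩
    refine ⟨l ++ [α] ++ l.reverse, R.ext_act fun v => ?_⟩
    rw [wordProd_append, wordProd_concat, wordProd_reverse, act_conj]
    change _ = (ℝ ∙ β)ᗮ.reflection v
    rcases h with h | h <;> rw [h]
    rw [reflection_apply_eq, reflection_apply_eq]
    simp [neg_div]
  | one => exact ⟨[], rfl⟩
  | mul x y _ _ hx hy =>
    obtain ⟨l, hl⟩ := hx
    obtain ⟨l', hl'⟩ := hy
    exact ⟨l ++ l', by rw [wordProd_append, hl, hl']; rfl⟩
  | inv x _ hx =>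
    obtain ⟨l, hl⟩ := hx
    exact ⟨l.reverse, by rw [wordProd_reverse, hl]; rfl⟩

theorem length_le (l : List R.simple) : R.length (R.wordProd l) ≤ l.length :=
  Nat.sInf_le ⟨l, rfl, rfl⟩

theorem exists_reduced (w : R.coxeterGroup) :
    ∃ l : List R.simple, l.length = R.length w ∧ R.wordProd l = w := by
  obtain ⟨l, hl⟩ := R.exists_wordProd_eq w
  exact Nat.sInf_mem (s := {n | ∃ l : List R.simple, l.length = n ∧ R.wordProd l = w})
    ⟨l.length, l, rfl, hl⟩

@[simp] theorem length_one : R.length 1 = 0 :=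
  Nat.le_zero.1 (R.length_le [])

theorem length_mul_simpleReflection_le (w : R.coxeterGroup) (α : R.simple) :
    R.length (w * R.simpleReflection α) ≤ R.length w + 1 := by
  obtain ⟨l, hl, rfl⟩ := R.exists_reduced w
  rw [← wordProd_concat, ← hl]
  simpa using R.length_le (l ++ [α])

theorem length_le_mul_simpleReflection (w : R.coxeterGroup) (α : R.simple) :
    R.length w ≤ R.length (w * R.simpleReflection α) + 1 := by
  simpa using R.length_mul_simpleReflection_le (w * R.simpleReflection α) α

/-- The exchange property. -/
theorem exists_exchange (l : List R.simple) (α : R.simple)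
    (h : -R.act (R.wordProd l) α ∈ R.posRoots) :
    ∃ l' : List R.simple, l'.length + 1 = l.length ∧
      R.wordProd l' = R.wordProd l * R.simpleReflection α := by
  induction l with
  | nil => exact absurd h (R.neg_notMem_posRoots (R.simple_mem_posRoots α.2))
  | cons γ l ih =>
    rcases R.mem_posRoots_or_neg (R.act_mem_roots (R.wordProd l) (R.simple_subset α.2)) with
      hp | hn
    -- Here `γ` is the letter whose reflection turns the root negative. A simple reflection does
    -- this only to its own root, so `γ` is the letter to delete.
    · have heq : R.act (R.wordProd l) α = R.act 1 γ := by
        by_contra hne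
        refine R.neg_notMem_posRoots (R.act_simpleReflection_mem γ hp hne) ?_
        rwa [wordProd_cons, act_mul] at h
      refine ⟨l, rfl, ?_⟩
      have hc := R.conj_eq_conj (Or.inl heq)
      rw [one_mul, inv_one, mul_one] at hc
      rw [wordProd_cons, ← hc]
      simp [mul_assoc]
    · obtain ⟨l', hl', hw⟩ := ih hn
      exact ⟨γ :: l', by simpa using hl', by rw [wordProd_cons, wordProd_cons, hw, mul_assoc]⟩

theorem length_of_descent {w : R.coxeterGroup} {α : R.simple} (h : -R.act w α ∈ R.posRoots) :
    R.length (w * R.simpleReflection α) + 1 = R.length w := by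
  obtain ⟨l, hl, rfl⟩ := R.exists_reduced w
  obtain ⟨l', hl', hw⟩ := R.exists_exchange l α h
  have h1 := R.length_le l'
  have h2 := R.length_le_mul_simpleReflection (R.wordProd l) α
  rw [hw] at h1
  omega

theorem act_mem_posRoots_of_length {w : R.coxeterGroup} {α : R.simple}
    (h : R.length w ≤ R.length (w * R.simpleReflection α)) : R.act w α ∈ R.posRoots := by
  rcases R.mem_posRoots_or_neg (R.act_mem_roots w (R.simple_subset α.2)) with hp | hn
  · exact hp
  · have := R.length_of_descent hn
    omega

/-- Inversions of `w` remain inversions after an ascent. -/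
theorem neg_act_inv_mem_of_ascent {w : R.coxeterGroup} {α : R.simple}
    (h : R.act w α ∈ R.posRoots) {β : V} (hβ : β ∈ R.posRoots)
    (hinv : -R.act w⁻¹ β ∈ R.posRoots) :
    -R.act (w * R.simpleReflection α)⁻¹ β ∈ R.posRoots := by
  -- The one inversion that `s_α` could destroy is `β = -wα`, which is negative.
  have hne : -R.act w⁻¹ β ≠ α := by
    intro he
    rw [neg_eq_iff_eq_neg, eq_act_iff, act_neg] at he
    exact R.neg_notMem_posRoots h (he ▸ hβ)
  have := R.act_simpleReflection_mem α hinv hne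
  rwa [act_neg, ← act_mul, ← simpleReflection_inv, ← mul_inv_rev] at this

/-! ### The weak order -/

/-- `σ` is covered by `τ` in the weak order. -/
def WeakCov (σ τ : R.coxeterGroup) : Prop :=
  ∃ α : R.simple, R.act σ α ∈ R.posRoots ∧ τ = σ * R.simpleReflection α

theorem weakCov_iff {σ τ : R.coxeterGroup} : R.WeakCov σ τ ↔
    ∃ α : R.simple, -R.act τ α ∈ R.posRoots ∧ σ = τ * R.simpleReflection α := by
  constructor
  · rintro ⟨α, h, rfl⟩
    exact ⟨α, by simpa using h, by simp⟩
  · rintro ⟨α, h, rfl⟩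
    exact ⟨α, by simpa using h, by simp⟩

theorem length_mul_wordProd_le (σ : R.coxeterGroup) (l : List R.simple) :
    R.length (σ * R.wordProd l) ≤ R.length σ + l.length := by
  induction l using List.reverseRecOn with
  | nil => simp
  | append_singleton l α ih =>
    have := R.length_mul_simpleReflection_le (σ * R.wordProd l) α
    rw [wordProd_concat, ← mul_assoc, List.length_append, List.length_singleton]
    omega

/-- Since each letter raises the length by at most one, additivity of lengths forces every letter of
a reduced word for the quotient to be an ascent. -/
theorem WeakLE.reflTransGen {σ τ : R.coxeterGroup} (h : R.WeakLE σ τ) :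
    Relation.ReflTransGen R.WeakCov σ τ := by
  obtain ⟨ρ, rfl, hlen⟩ := h
  obtain ⟨l, hl, rfl⟩ := R.exists_reduced ρ
  rw [← hl] at hlen
  clear hl
  induction l using List.reverseRecOn with
  | nil => simpa using Relation.ReflTransGen.refl
  | append_singleton l α ih =>
    have h1 := R.length_mul_wordProd_le σ l
    have h2 := R.length_mul_simpleReflection_le (σ * R.wordProd l) α
    rw [wordProd_concat, ← mul_assoc] at hlen ⊢
    rw [List.length_append, List.length_singleton] at hlen
    refine (ih (by omega)).tail ⟨α, R.act_mem_posRoots_of_length (by omega), rfl⟩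

theorem WeakLE.neg_act_inv_mem {σ τ : R.coxeterGroup} (h : R.WeakLE σ τ) {β : V}
    (hβ : β ∈ R.posRoots) (hinv : -R.act σ⁻¹ β ∈ R.posRoots) :
    -R.act τ⁻¹ β ∈ R.posRoots := by
  replace h := WeakLE.reflTransGen R h
  induction h with
  | refl => exact hinv
  | tail _ hc ih =>
    obtain ⟨α, hα, rfl⟩ := hc
    exact R.neg_act_inv_mem_of_ascent hα hβ ih

theorem exists_descent {w : R.coxeterGroup} (hw : w ≠ 1) :
    ∃ α : R.simple, -R.act w α ∈ R.posRoots := by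
  obtain ⟨l, hl, rfl⟩ := R.exists_reduced w
  rcases List.eq_nil_or_concat l with rfl | ⟨l', α, rfl⟩
  · exact absurd rfl hw
  · refine ⟨α, ?_⟩
    rw [List.concat_eq_append, wordProd_concat] at hl ⊢
    have h1 := R.length_le l'
    rw [List.length_append, List.length_singleton] at hl
    simpa using R.act_mem_posRoots_of_length (w := R.wordProd l') (α := α) (by omega)

variable {m : ℕ} (Q : Fin m → R.simple)

/-! ### Prefix products of subwords -/

theorem subword_insert {C : Finset (Fin m)} {k : Fin m} (hC : ∀ i ∈ C, i < k) :
    R.subword Q (insert k C) = R.subword Q C ++ [Q k] := by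
  obtain ⟨a, b, hab⟩ := List.append_of_mem (List.mem_finRange k)
  have hp : (a ++ k :: b).Pairwise (· < ·) := hab ▸ List.pairwise_lt_finRange m
  rw [List.pairwise_append, List.pairwise_cons] at hp
  obtain ⟨-, ⟨hb, -⟩, ha⟩ := hp
  have ha' : ∀ i ∈ a, i < k := fun i hi => ha i hi k List.mem_cons_self
  have h1 : a.filter (fun i => i ∈ insert k C) = a.filter (fun i => i ∈ C) := by
    refine List.filter_congr fun i hi => ?_
    simp [(ha' i hi).ne]
  have h2 : b.filter (fun i => i ∈ insert k C) = [] := by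
    rw [List.filter_eq_nil_iff]
    intro i hi h
    have := hb i hi
    rcases Finset.mem_insert.1 (of_decide_eq_true h) with rfl | h
    · exact lt_irrefl _ this
    · exact lt_asymm this (hC i h)
  have h3 : b.filter (fun i => i ∈ C) = [] := by
    rw [List.filter_eq_nil_iff]
    exact fun i hi h => lt_asymm (hb i hi) (hC i (of_decide_eq_true h))
  have h4 : k ∉ C := fun h => lt_irrefl _ (hC k h)
  unfold subword
  rw [hab, List.filter_append, List.filter_append, List.filter_cons, List.filter_cons, h1, h2, h3]
  simp [h4]

theorem length_subword (C : Finset (Fin m)) : (R.subword Q C).length = C.card := by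
  rw [subword, List.length_map, ← List.toFinset_card_of_nodup
    ((List.nodup_finRange m).filter _)]
  congr 1
  ext i
  simp

/-- The positions of `C` before `n`. -/
def below (C : Finset (Fin m)) (n : ℕ) : Finset (Fin m) := C.filter fun i => (i : ℕ) < n

/-- The product of the letters at the positions of `C` before `n`. -/
noncomputable def pre (C : Finset (Fin m)) (n : ℕ) : R.coxeterGroup :=
  R.wordProd (R.subword Q (below C n))

theorem below_succ_of_mem {C : Finset (Fin m)} {k : Fin m} (hk : k ∈ C) :
    below C (k + 1) = insert k (below C k) := by
  ext i
  simp only [below, Finset.mem_filter, Finset.mem_insert, Fin.ext_iff]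
  constructor
  · rintro ⟨h1, h2⟩
    by_cases h : (i : ℕ) = k
    · exact Or.inl h
    · exact Or.inr ⟨h1, by omega⟩
  · rintro (h | ⟨h1, h2⟩)
    · rw [Fin.ext h]
      exact ⟨hk, Nat.lt_succ_self _⟩
    · exact ⟨h1, by omega⟩

theorem below_succ_of_notMem {C : Finset (Fin m)} {k : Fin m} (hk : k ∉ C) :
    below C (k + 1) = below C k := by
  ext i
  simp only [below, Finset.mem_filter]
  refine and_congr_right fun hi => ?_
  have : (i : ℕ) ≠ k := fun h => hk (Fin.ext h ▸ hi)
  omega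

theorem card_below_succ_of_mem {C : Finset (Fin m)} {k : Fin m} (hk : k ∈ C) :
    (below C (k + 1)).card = (below C k).card + 1 := by
  rw [below_succ_of_mem hk, Finset.card_insert_of_notMem (by simp [below])]

theorem below_eq_self (C : Finset (Fin m)) : below C m = C :=
  Finset.filter_true_of_mem fun i _ => i.2

@[simp] theorem pre_zero (C : Finset (Fin m)) : R.pre Q C 0 = 1 := by
  have : below C 0 = ∅ := by simp [below]
  simp [pre, this, subword]

theorem pre_succ_of_mem {C : Finset (Fin m)} {k : Fin m} (hk : k ∈ C) :
    R.pre Q C (k + 1) = R.pre Q C k * R.simpleReflection (Q k) := by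
  rw [pre, below_succ_of_mem hk, subword_insert, wordProd_concat, pre]
  intro i hi
  exact (Finset.mem_filter.1 hi).2

theorem pre_succ_of_notMem {C : Finset (Fin m)} {k : Fin m} (hk : k ∉ C) :
    R.pre Q C (k + 1) = R.pre Q C k := by
  rw [pre, below_succ_of_notMem hk, pre]

theorem pre_last (C : Finset (Fin m)) : R.pre Q C m = R.wordProd (R.subword Q C) := by
  rw [pre, below_eq_self]

/-- The root at position `k` of the subword of `Q` on `C`. -/
noncomputable def rootAt (C : Finset (Fin m)) (k : Fin m) : V := R.act (R.pre Q C k) (Q k)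

theorem rootFunction_eq (I : Finset (Fin m)) (k : Fin m) :
    R.rootFunction Q I k = R.rootAt Q Iᶜ k := by
  have : Finset.Iio k \ I = below Iᶜ k := by
    ext i
    simp [below, and_comm]
  rw [rootFunction, this]
  rfl

theorem rootAt_mem_roots (C : Finset (Fin m)) (k : Fin m) : R.rootAt Q C k ∈ R.roots :=
  R.act_mem_roots _ (R.simple_subset (Q k).2)

theorem act_inv_pre_rootAt (C : Finset (Fin m)) (k : Fin m) :
    R.act (R.pre Q C k)⁻¹ (R.rootAt Q C k) = Q k :=
  R.act_inv_act _ _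

theorem length_pre_le (C : Finset (Fin m)) (n : ℕ) : R.length (R.pre Q C n) ≤ (below C n).card := by
  rw [← R.length_subword Q]
  exact R.length_le _

/-- The defect, number of letters minus length, never decreases along prefixes. For a reduced
subword it ends at `0`, hence vanishes throughout. -/
theorem length_pre_add_le (C : Finset (Fin m)) {a b : ℕ} (hab : a ≤ b) (hb : b ≤ m) :
    R.length (R.pre Q C b) + (below C a).card ≤ R.length (R.pre Q C a) + (below C b).card := by
  induction b, hab using Nat.le_induction with
  | base => exact le_rfl
  | succ n hn ih =>
    have ih := ih (by omega)
    let k : Fin m := ⟨n, hb⟩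
    by_cases hk : k ∈ C
    · have h1 := R.pre_succ_of_mem Q hk
      have h2 := card_below_succ_of_mem hk
      have h3 := R.length_mul_simpleReflection_le (R.pre Q C k) (Q k)
      rw [← h1] at h3
      change R.length (R.pre Q C (n + 1)) ≤ R.length (R.pre Q C n) + 1 at h3
      change (below C (n + 1)).card = (below C n).card + 1 at h2
      omega
    · have h1 := R.pre_succ_of_notMem Q hk
      have h2 := below_succ_of_notMem hk
      change R.pre Q C (n + 1) = R.pre Q C n at h1
      change below C (n + 1) = below C n at h2
      rw [h1, h2]
      exact ih

variable {Q}

/-! ### Signs and crossings of roots along a reduced subword -/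

section Reduced

variable {R} {C : Finset (Fin m)} {ω : R.coxeterGroup}

theorem IsReducedExpr.pre_last (hC : R.IsReducedExpr (R.subword Q C) ω) : R.pre Q C m = ω :=
  (R.pre_last Q C).trans hC.1

/-- In a reduced subword, the roots at the letters used are positive. -/
theorem IsReducedExpr.rootAt_mem_posRoots (hC : R.IsReducedExpr (R.subword Q C) ω) {k : Fin m}
    (hk : k ∈ C) : R.rootAt Q C k ∈ R.posRoots := by
  refine R.act_mem_posRoots_of_length ?_
  rw [← R.pre_succ_of_mem Q hk]
  have h1 := R.length_pre_add_le Q C (a := k + 1) (b := m) k.2 le_rfl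
  have h2 := R.length_pre_le Q C k
  have h3 := card_below_succ_of_mem hk
  have h4 := hC.2
  rw [hC.pre_last, ← h4, below_eq_self, R.length_subword] at h1
  omega

/-- Inversions of a prefix of a reduced subword are inversions of longer prefixes. -/
theorem IsReducedExpr.neg_mono (hC : R.IsReducedExpr (R.subword Q C) ω) {β : V}
    (hβ : β ∈ R.posRoots) {a b : ℕ} (hab : a ≤ b) (hb : b ≤ m)
    (h : -R.act (R.pre Q C a)⁻¹ β ∈ R.posRoots) : -R.act (R.pre Q C b)⁻¹ β ∈ R.posRoots := by
  induction b, hab using Nat.le_induction with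
  | base => exact h
  | succ n hn ih =>
    have ih := ih (by omega)
    let k : Fin m := ⟨n, hb⟩
    by_cases hk : k ∈ C
    · have := R.neg_act_inv_mem_of_ascent (hC.rootAt_mem_posRoots hk) hβ ih
      rwa [← R.pre_succ_of_mem Q hk] at this
    · have := R.pre_succ_of_notMem Q hk
      change R.pre Q C (n + 1) = R.pre Q C n at this
      rwa [this]

/-- Just after `j` the inverse prefix sends the root to `-α_{q_j}`, and inversions persist. -/
theorem IsReducedExpr.neg_after (hC : R.IsReducedExpr (R.subword Q C) ω) {j : Fin m}
    (hj : j ∈ C) {n : ℕ} (hjn : (j : ℕ) < n) (hn : n ≤ m) :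
    -R.act (R.pre Q C n)⁻¹ (R.rootAt Q C j) ∈ R.posRoots := by
  refine hC.neg_mono (hC.rootAt_mem_posRoots hj) (Nat.succ_le_of_lt hjn) hn ?_
  rw [Nat.succ_eq_add_one, R.pre_succ_of_mem Q hj, mul_inv_rev, act_mul, act_inv_pre_rootAt,
    simpleReflection_inv, act_simpleReflection_self, neg_neg]
  exact R.simple_mem_posRoots (Q j).2

/-- After the crossing of a root, its occurrences are negative. -/
theorem IsReducedExpr.rootAt_ne_of_lt (hC : R.IsReducedExpr (R.subword Q C) ω) {j k : Fin m}
    (hj : j ∈ C) (hjk : j < k) : R.rootAt Q C k ≠ R.rootAt Q C j := by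
  intro he
  have := hC.neg_after hj (n := k) hjk k.2.le
  rw [← he, act_inv_pre_rootAt] at this
  exact R.neg_notMem_posRoots (R.simple_mem_posRoots (Q k).2) this

/-- Before the crossing of a root, its occurrences are positive. -/
theorem IsReducedExpr.rootAt_ne_neg_of_lt (hC : R.IsReducedExpr (R.subword Q C) ω) {j k : Fin m}
    (hj : j ∈ C) (hkj : k < j) : R.rootAt Q C k ≠ -R.rootAt Q C j := by
  intro he
  have h : -R.act (R.pre Q C k)⁻¹ (R.rootAt Q C j) ∈ R.posRoots := by
    rw [← act_neg, ← he, act_inv_pre_rootAt]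
    exact R.simple_mem_posRoots (Q k).2
  have := hC.neg_mono (hC.rootAt_mem_posRoots hj) (b := j) hkj.le j.2.le h
  rw [act_inv_pre_rootAt] at this
  exact R.neg_notMem_posRoots (R.simple_mem_posRoots (Q j).2) this

theorem IsReducedExpr.crossing_unique (hC : R.IsReducedExpr (R.subword Q C) ω) {j k : Fin m}
    (hj : j ∈ C) (hk : k ∈ C) (h : R.rootAt Q C j = R.rootAt Q C k) : j = k := by
  rcases lt_trichotomy j k with hlt | he | hlt
  · exact absurd h.symm (hC.rootAt_ne_of_lt hj hlt)
  · exact he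
  · exact absurd h (hC.rootAt_ne_of_lt hk hlt)

end Reduced

variable (Q)

/-- A root that changes sign between two prefixes is crossed in between. -/
theorem exists_crossing (C : Finset (Fin m)) {β : V} {a b : ℕ} (hab : a ≤ b) (hb : b ≤ m)
    (ha : R.act (R.pre Q C a)⁻¹ β ∈ R.posRoots) (hneg : -R.act (R.pre Q C b)⁻¹ β ∈ R.posRoots) :
    ∃ j ∈ C, a ≤ (j : ℕ) ∧ (j : ℕ) < b ∧ R.rootAt Q C j = β := by
  induction b, hab using Nat.le_induction with
  | base => exact absurd hneg (R.neg_notMem_posRoots ha)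
  | succ n hn ih =>
    let k : Fin m := ⟨n, hb⟩
    by_cases h : -R.act (R.pre Q C n)⁻¹ β ∈ R.posRoots
    · obtain ⟨j, hj, h1, h2, h3⟩ := ih (by omega) h
      exact ⟨j, hj, h1, by omega, h3⟩
    by_cases hk : k ∈ C
    · have hpos : R.act (R.pre Q C n)⁻¹ β ∈ R.posRoots := by
        refine (R.mem_posRoots_or_neg ?_).resolve_right h
        have h2 := R.act_mem_roots (R.pre Q C a) ha.1
        rw [act_act_inv] at h2
        exact R.act_mem_roots _ h2
      -- Only its own simple root is made negative by the reflection of letter `k`.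
      have he : R.act (R.pre Q C n)⁻¹ β = Q k := by
        by_contra hne
        refine R.neg_notMem_posRoots (R.act_simpleReflection_mem (Q k) hpos hne) ?_
        have := R.pre_succ_of_mem Q hk
        change R.pre Q C (n + 1) = R.pre Q C n * _ at this
        rwa [this, mul_inv_rev, act_mul, simpleReflection_inv] at hneg
      exact ⟨k, hk, hn, Nat.lt_succ_self n, ((R.eq_act_iff).1 he).symm⟩
    · have := R.pre_succ_of_notMem Q hk
      change R.pre Q C (n + 1) = R.pre Q C n at this
      rw [this] at hneg
      exact absurd hneg h

/-! ### Flips -/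

/-- The reflection orthogonal to the root at position `k`. -/
noncomputable def reflAt (C : Finset (Fin m)) (k : Fin m) : R.coxeterGroup :=
  R.pre Q C k * R.simpleReflection (Q k) * (R.pre Q C k)⁻¹

theorem reflAt_mul_self (C : Finset (Fin m)) (k : Fin m) : R.reflAt Q C k * R.reflAt Q C k = 1 := by
  simp [reflAt, ← mul_assoc]

theorem act_reflAt_rootAt (C : Finset (Fin m)) (k : Fin m) :
    R.act (R.reflAt Q C k) (R.rootAt Q C k) = -R.rootAt Q C k := by
  rw [reflAt, act_mul, act_inv_pre_rootAt, act_mul, act_simpleReflection_self, act_neg, rootAt]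

/-- Exchanging the membership of `k` multiplies the next prefix product by a reflection. -/
theorem pre_succ_eq_reflAt_mul {C D : Finset (Fin m)} {k : Fin m} (h : k ∈ D ↔ k ∉ C)
    (hpre : R.pre Q D k = R.pre Q C k) :
    R.pre Q D (k + 1) = R.reflAt Q C k * R.pre Q C (k + 1) := by
  by_cases hk : k ∈ C
  · rw [R.pre_succ_of_mem Q hk, R.pre_succ_of_notMem Q (fun hD => h.1 hD hk), hpre, reflAt]
    simp [← mul_assoc]
  · rw [R.pre_succ_of_notMem Q hk, R.pre_succ_of_mem Q (h.2 hk), hpre, reflAt]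
    simp [mul_assoc]

theorem pre_succ_eq_mul {C D : Finset (Fin m)} {k : Fin m} (h : k ∈ D ↔ k ∈ C)
    {t : R.coxeterGroup} (hpre : R.pre Q D k = t * R.pre Q C k) :
    R.pre Q D (k + 1) = t * R.pre Q C (k + 1) := by
  by_cases hk : k ∈ C
  · rw [R.pre_succ_of_mem Q hk, R.pre_succ_of_mem Q (h.2 hk), hpre, mul_assoc]
  · rw [R.pre_succ_of_notMem Q hk, R.pre_succ_of_notMem Q (fun hD => hk (h.1 hD)), hpre]

section Flip

variable {R Q} {C : Finset (Fin m)} {a b : Fin m}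

theorem mem_flip_iff {k : Fin m} (ha : k ≠ a) (hb : k ≠ b) :
    k ∈ symmDiff C {a, b} ↔ k ∈ C := by
  simp [Finset.mem_symmDiff, ha, hb]

theorem mem_flip_left : a ∈ symmDiff C {a, b} ↔ a ∉ C := by
  simp [Finset.mem_symmDiff]

theorem mem_flip_right : b ∈ symmDiff C {a, b} ↔ b ∉ C := by
  simp [Finset.mem_symmDiff]

theorem pre_flip_of_le (hab : a < b) {n : ℕ} (hn : n ≤ a) :
    R.pre Q (symmDiff C {a, b}) n = R.pre Q C n := by
  have : below (symmDiff C {a, b}) n = below C n := by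
    ext i
    simp only [below, Finset.mem_filter, and_congr_left_iff]
    intro hi
    exact mem_flip_iff (fun h => by subst h; omega) (fun h => by subst h; omega)
  rw [pre, this, pre]

/-- Inserting or deleting the letter at `a` multiplies later prefixes on the left by the reflection
in its root, until `b` is reached. -/
theorem pre_flip_between (hab : a < b) {n : ℕ} (han : a < n) (hn : n ≤ b) :
    R.pre Q (symmDiff C {a, b}) n = R.reflAt Q C a * R.pre Q C n := by
  induction n, Nat.succ_le_of_lt han using Nat.le_induction with
  | base => exact R.pre_succ_eq_reflAt_mul Q mem_flip_left (pre_flip_of_le hab le_rfl)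
  | succ n h ih =>
    have hb := b.2
    let k : Fin m := ⟨n, by omega⟩
    refine R.pre_succ_eq_mul Q (k := k) (mem_flip_iff ?_ ?_) (ih (by omega) (by omega)) <;>
    · intro he
      have := congrArg Fin.val he
      change n = _ at this
      omega

theorem reflAt_eq_reflAt
    (hr : R.rootAt Q C a = R.rootAt Q C b ∨ R.rootAt Q C a = -R.rootAt Q C b) :
    R.reflAt Q C a = R.reflAt Q C b :=
  R.conj_eq_conj hr

/-- The change at `b` contributes the same reflection as the one at `a`, because the roots agree up
to sign, and the two cancel. -/
theorem pre_flip_of_lt (hab : a < b)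
    (hr : R.rootAt Q C a = R.rootAt Q C b ∨ R.rootAt Q C a = -R.rootAt Q C b)
    {n : ℕ} (hbn : b < n) (hn : n ≤ m) :
    R.pre Q (symmDiff C {a, b}) n = R.pre Q C n := by
  induction n, Nat.succ_le_of_lt hbn using Nat.le_induction with
  | base =>
    have h1 := pre_flip_between (R := R) (Q := Q) (C := C) hab hab le_rfl
    have h2 : R.pre Q C b = R.reflAt Q C a * R.pre Q (symmDiff C {a, b}) b := by
      rw [h1, ← mul_assoc, reflAt_mul_self, one_mul]
    rw [reflAt_eq_reflAt hr] at h1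
    by_cases hb : b ∈ C
    · rw [Nat.succ_eq_add_one, R.pre_succ_of_mem Q hb,
        R.pre_succ_of_notMem Q (fun h => mem_flip_right.1 h hb), h1, reflAt]
      simp
    · rw [Nat.succ_eq_add_one, R.pre_succ_of_notMem Q hb,
        R.pre_succ_of_mem Q (mem_flip_right.2 hb), h1, reflAt]
      simp
  | succ n h ih =>
    let k : Fin m := ⟨n, hn⟩
    have hab' : (a : ℕ) < b := hab
    have := R.pre_succ_eq_mul Q (C := C) (D := symmDiff C {a, b}) (k := k) (t := 1)
      (mem_flip_iff ?_ ?_) ((ih (by omega) (by omega)).trans (one_mul _).symm)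
    · rwa [one_mul] at this
    all_goals
      intro he
      have := congrArg Fin.val he
      change n = _ at this
      omega

theorem card_flip (hx : a ∈ C ↔ b ∉ C) : (symmDiff C {a, b}).card = C.card := by
  by_cases ha : a ∈ C
  · have hb := hx.1 ha
    have : symmDiff C {a, b} = insert b (C.erase a) := by
      ext i
      simp only [Finset.mem_symmDiff, Finset.mem_insert, Finset.mem_singleton, Finset.mem_erase]
      grind
    rw [this, Finset.card_insert_of_notMem (fun h => hb (Finset.mem_of_mem_erase h)),
      Finset.card_erase_add_one ha]
  · have hb : b ∈ C := by tauto
    have : symmDiff C {a, b} = insert a (C.erase b) := by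
      ext i
      simp only [Finset.mem_symmDiff, Finset.mem_insert, Finset.mem_singleton, Finset.mem_erase]
      grind
    rw [this, Finset.card_insert_of_notMem (fun h => ha (Finset.mem_of_mem_erase h)),
      Finset.card_erase_add_one hb]

/-- Flips preserve reduced expressions. -/
theorem IsReducedExpr.flip {ω : R.coxeterGroup} (hC : R.IsReducedExpr (R.subword Q C) ω)
    (hab : a < b) (hx : a ∈ C ↔ b ∉ C)
    (hr : R.rootAt Q C a = R.rootAt Q C b ∨ R.rootAt Q C a = -R.rootAt Q C b) :
    R.IsReducedExpr (R.subword Q (symmDiff C {a, b})) ω := by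
  refine ⟨?_, ?_⟩
  · rw [← R.pre_last, pre_flip_of_lt hab hr b.2 le_rfl, hC.pre_last]
  · rw [R.length_subword, card_flip hx, ← R.length_subword Q, hC.2]

theorem rootAt_flip_of_le (hab : a < b) {k : Fin m} (hk : k ≤ a) :
    R.rootAt Q (symmDiff C {a, b}) k = R.rootAt Q C k := by
  rw [rootAt, pre_flip_of_le hab hk, rootAt]

theorem rootAt_flip_between (hab : a < b) {k : Fin m} (hak : a < k) (hk : k ≤ b) :
    R.rootAt Q (symmDiff C {a, b}) k = R.act (R.reflAt Q C a) (R.rootAt Q C k) := by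
  rw [rootAt, pre_flip_between hab hak hk, act_mul, rootAt]

theorem rootAt_flip_of_lt (hab : a < b)
    (hr : R.rootAt Q C a = R.rootAt Q C b ∨ R.rootAt Q C a = -R.rootAt Q C b)
    {k : Fin m} (hk : b < k) :
    R.rootAt Q (symmDiff C {a, b}) k = R.rootAt Q C k := by
  rw [rootAt, pre_flip_of_lt hab hr hk k.2.le, rootAt]

end Flip

end BasedRootSystem
end SubwordCplx

namespace SubwordCplx
namespace BasedRootSystem

variable {V : Type*} [NormedAddCommGroup V] [InnerProductSpace ℝ V] {R : BasedRootSystem V}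
variable {m : ℕ} {Q : Fin m → R.simple} {C : Finset (Fin m)} {π ω : R.coxeterGroup}

/-! ### Linear extensions -/

variable (R Q) in
/-- All the roots at the letters omitted by the subword on `C` lie in `π(Φ⁺)`. -/
def Compatible (C : Finset (Fin m)) (π : R.coxeterGroup) : Prop :=
  ∀ k ∉ C, R.act π⁻¹ (R.rootAt Q C k) ∈ R.posRoots

theorem mem_linearExtensions_iff {I : Finset (Fin m)} :
    π ∈ R.linearExtensions Q I ↔ R.Compatible Q Iᶜ π := by
  constructor
  · intro h k hk
    obtain ⟨β, hβ, he⟩ := h ⟨k, by simpa using hk, R.rootFunction_eq Q I k⟩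
    rw [← he]
    change R.act π⁻¹ (R.act π β) ∈ R.posRoots
    rwa [act_inv_act]
  · rintro h _ ⟨k, hk, rfl⟩
    refine ⟨_, h k (by simpa using hk), ?_⟩
    rw [R.rootFunction_eq]
    exact R.act_act_inv _ _

/-- Descending along a cover of the weak order, a compatible facet either stays compatible, or has
a compatible flip from which it can be recovered. -/
theorem exists_compatible_descent (hC : R.IsReducedExpr (R.subword Q C) ω)
    (hπ : R.Compatible Q C π) {α : R.simple} (hα : -R.act π α ∈ R.posRoots) :
    R.Compatible Q C (π * R.simpleReflection α) ∨
    ∃ D : Finset (Fin m), R.IsReducedExpr (R.subword Q D) ω ∧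
      R.Compatible Q D (π * R.simpleReflection α) ∧
      ∃ j i : Fin m, j ∉ D ∧ i ∈ D ∧ R.rootAt Q D j = -R.act π α ∧
        R.rootAt Q D i = -R.act π α ∧
        (∀ k < j, k ∉ D → R.rootAt Q D k ≠ -R.act π α) ∧ C = symmDiff D {j, i} := by
  classical
  -- Passing from `π` to `π s_α` removes only `πα` from the image of `Φ⁺`.
  have hstep : ∀ v : V, R.act π⁻¹ v ∈ R.posRoots → v ≠ R.act π α →
      R.act (π * R.simpleReflection α)⁻¹ v ∈ R.posRoots := by
    intro v hv hne
    rw [mul_inv_rev, act_mul, simpleReflection_inv]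
    exact R.act_simpleReflection_mem α hv fun h => hne (R.eq_act_iff.1 h)
  let T : Finset (Fin m) := Finset.univ.filter fun k => k ∉ C ∧ R.rootAt Q C k = R.act π α
  rcases T.eq_empty_or_nonempty with hT | hT
  · left
    refine fun k hk => hstep _ (hπ k hk) fun h => ?_
    have : k ∈ T := by simp [T, hk, h]
    simp [hT] at this
  right
  obtain ⟨hiC, hi⟩ : T.max' hT ∉ C ∧ R.rootAt Q C (T.max' hT) = R.act π α := by
    simpa [T] using T.max'_mem hT
  have hmax : ∀ k ∉ C, R.rootAt Q C k = R.act π α → k ≤ T.max' hT :=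
    fun k hk h => T.le_max' k (by simp [T, hk, h])
  generalize T.max' hT = i at hiC hi hmax
  clear hT T
  set β : V := -R.act π α with hβ
  have hi' : R.rootAt Q C i = -β := by rw [hi, hβ, neg_neg]
  -- `β` is positive at the start and negative at `i`, so it is crossed before `i`.
  obtain ⟨j, hjC, -, hji, hj⟩ := R.exists_crossing Q C (β := β) (a := 0) (b := i)
    (Nat.zero_le _) i.2.le (by simpa using hα) (by
      rw [← act_neg, ← hi', act_inv_pre_rootAt]
      exact R.simple_mem_posRoots (Q i).2)
  have hji : j < i := hji
  have hr : R.rootAt Q C j = R.rootAt Q C i ∨ R.rootAt Q C j = -R.rootAt Q C i :=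
    Or.inr (by rw [hj, hi', neg_neg])
  have hπβ : R.act π⁻¹ β = -α := by rw [hβ, act_neg, act_inv_act]
  have hnotβ : ∀ k ∉ C, R.rootAt Q C k ≠ β := by
    intro k hk h
    have := hπ k hk
    rw [h, hπβ] at this
    exact R.neg_notMem_posRoots (R.simple_mem_posRoots α.2) this
  have hrefl : R.reflAt Q C j = π * R.simpleReflection α * π⁻¹ := R.conj_eq_conj (Or.inr hj)
  have hDj : R.rootAt Q (symmDiff C {j, i}) j = β := by rw [rootAt_flip_of_le hji le_rfl, hj]
  refine ⟨symmDiff C {j, i}, hC.flip hji (by tauto) hr, ?_, j, i,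
    fun h => mem_flip_left.1 h hjC, mem_flip_right.2 hiC, hDj, ?_, ?_, ?_⟩
  · intro k hk
    by_cases hkj : k = j
    · subst hkj
      rw [hDj, mul_inv_rev, act_mul, hπβ, simpleReflection_inv, act_neg,
        act_simpleReflection_self, neg_neg]
      exact R.simple_mem_posRoots α.2
    have hki : k ≠ i := fun h => hk (by rw [h]; exact mem_flip_right.2 hiC)
    have hkC : k ∉ C := fun h => hk ((mem_flip_iff hkj hki).2 h)
    rcases lt_or_gt_of_ne hkj with h1 | h1
    · rw [rootAt_flip_of_le hji h1.le]
      -- Before its crossing at `j`, `β` cannot occur with a minus sign.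
      refine hstep _ (hπ k hkC) fun h => hC.rootAt_ne_neg_of_lt hjC h1 ?_
      rw [h, hj, hβ, neg_neg]
    rcases lt_or_gt_of_ne hki with h2 | h2
    · rw [rootAt_flip_between hji h1 h2.le, hrefl, ← act_mul]
      -- The reflection in `β` is `π s_α π⁻¹`, so the reflected roots satisfy the old condition for
      -- `π`.
      have : (π * R.simpleReflection α)⁻¹ * (π * R.simpleReflection α * π⁻¹) = π⁻¹ := by group
      rw [this]
      exact hπ k hkC
    · rw [rootAt_flip_of_lt hji hr h2]
      -- This is why `i` was taken last.
      exact hstep _ (hπ k hkC) fun h => (hmax k hkC h).not_gt h2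
  · rw [rootAt_flip_between hji hji le_rfl, hi', act_neg, ← hj, act_reflAt_rootAt, neg_neg]
  · intro k hkj hk
    rw [rootAt_flip_of_le hji hkj.le]
    refine hnotβ k fun h => hk ((mem_flip_iff hkj.ne (hkj.trans hji).ne).2 h)
  · rw [symmDiff_symmDiff_cancel_right]

theorem compatible_of_weakCov (hC : R.IsReducedExpr (R.subword Q C) ω)
    {σ τ : R.coxeterGroup} (h : R.WeakCov σ τ) (hτ : R.Compatible Q C τ) :
    ∃ D : Finset (Fin m), R.IsReducedExpr (R.subword Q D) ω ∧ R.Compatible Q D σ := by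
  obtain ⟨α, hα, rfl⟩ := R.weakCov_iff.1 h
  rcases exists_compatible_descent hC hτ hα with h | ⟨D, hD, hc, -⟩
  · exact ⟨C, hC, h⟩
  · exact ⟨D, hD, hc⟩

/-- With all omitted roots positive, position `k` is used exactly when the prefix product through
`k` sends `α_{q_k}` to a negative root. Starting from `ω` at the right end, this determines each
choice and the preceding prefix. -/
theorem eq_of_compatible_one {D : Finset (Fin m)} (hC : R.IsReducedExpr (R.subword Q C) ω)
    (hD : R.IsReducedExpr (R.subword Q D) ω) (hC1 : R.Compatible Q C 1)
    (hD1 : R.Compatible Q D 1) : C = D := by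
  have hsign : ∀ {E : Finset (Fin m)}, R.IsReducedExpr (R.subword Q E) ω → R.Compatible Q E 1 →
      ∀ k : Fin m, k ∈ E ↔ -R.act (R.pre Q E (k + 1)) (Q k) ∈ R.posRoots := by
    intro E hE hE1 k
    by_cases hk : k ∈ E
    · rw [R.pre_succ_of_mem Q hk, act_mul, act_simpleReflection_self, act_neg, neg_neg]
      exact iff_of_true hk (hE.rootAt_mem_posRoots hk)
    · rw [R.pre_succ_of_notMem Q hk]
      refine iff_of_false hk (R.neg_notMem_posRoots ?_)
      have := hE1 k hk
      rwa [inv_one, act_one] at this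
  have key : ∀ d n : ℕ, n + d = m → R.pre Q C n = R.pre Q D n := by
    intro d
    induction d with
    | zero =>
      rintro n rfl
      rw [add_zero] at *
      exact hC.pre_last.trans hD.pre_last.symm
    | succ d ih =>
      intro n hn
      let k : Fin m := ⟨n, by omega⟩
      have h : R.pre Q C (k + 1) = R.pre Q D (k + 1) := ih (n + 1) (by omega)
      have hiff : k ∈ C ↔ k ∈ D := by rw [hsign hC hC1, hsign hD hD1, h]
      by_cases hk : k ∈ C
      · rw [R.pre_succ_of_mem Q hk, R.pre_succ_of_mem Q (hiff.1 hk)] at h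
        exact mul_right_cancel h
      · rwa [R.pre_succ_of_notMem Q hk, R.pre_succ_of_notMem Q (fun hD => hk (hiff.2 hD))] at h
  ext k
  rw [hsign hC hC1, hsign hD hD1, key (m - (k + 1)) (k + 1) (by omega)]

/-- At most one facet has a given linear extension. -/
theorem eq_of_compatible {D : Finset (Fin m)} (hC : R.IsReducedExpr (R.subword Q C) ω)
    (hD : R.IsReducedExpr (R.subword Q D) ω) (hCπ : R.Compatible Q C π)
    (hDπ : R.Compatible Q D π) : C = D := by
  induction hn : R.length π generalizing π C D with
  | zero =>
    obtain ⟨l, hl, rfl⟩ := R.exists_reduced π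
    rw [hn, List.length_eq_zero_iff] at hl
    subst hl
    exact eq_of_compatible_one hC hD hCπ hDπ
  | succ n ih =>
    obtain ⟨α, hα⟩ := R.exists_descent (w := π) (by rintro rfl; simp at hn)
    have hlen := R.length_of_descent hα
    have ih {C' D' : Finset (Fin m)} (h1 : R.IsReducedExpr (R.subword Q C') ω)
        (h2 : R.IsReducedExpr (R.subword Q D') ω)
        (h3 : R.Compatible Q C' (π * R.simpleReflection α))
        (h4 : R.Compatible Q D' (π * R.simpleReflection α)) : C' = D' :=
      ih h1 h2 h3 h4 (by omega)
    -- A flipped subword omits a position with root `-πα`, so it is not compatible with `π`; this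
    -- excludes one subword being flipped and the other not.
    have hmixed : ∀ {E : Finset (Fin m)}, R.Compatible Q E π → ∀ j : Fin m, j ∉ E →
        R.rootAt Q E j ≠ -R.act π α := by
      intro E hE j hj h
      have := hE j hj
      rw [h, act_neg, act_inv_act] at this
      exact R.neg_notMem_posRoots (R.simple_mem_posRoots α.2) this
    rcases exists_compatible_descent hC hCπ hα with
      h1 | ⟨C', hC', h1, j, i, hj, hi, hrj, hri, hmin, hCC⟩ <;>
    rcases exists_compatible_descent hD hDπ hα with
      h2 | ⟨D', hD', h2, j', i', hj', hi', hrj', hri', hmin', hDD⟩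
    · exact ih hC hD h1 h2
    · obtain rfl := ih hC hD' h1 h2
      exact absurd hrj' (hmixed hCπ j' hj')
    · obtain rfl := ih hC' hD h1 h2
      exact absurd hrj (hmixed hDπ j hj)
    · obtain rfl := ih hC' hD' h1 h2
      obtain rfl : i = i' := hC'.crossing_unique hi hi' (hri.trans hri'.symm)
      obtain rfl : j = j' := by
        rcases lt_trichotomy j j' with h | h | h
        · exact absurd hrj (hmin' j h hj)
        · exact h
        · exact absurd hrj' (hmin j' h hj')
      rw [hCC, hDD]

/-- The facet with the earliest crossings has `ω` as a linear extension. -/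
theorem exists_compatible_self (hC : R.IsReducedExpr (R.subword Q C) ω) :
    ∃ D : Finset (Fin m), R.IsReducedExpr (R.subword Q D) ω ∧ R.Compatible Q D ω := by
  obtain ⟨D, hD, hmin⟩ := Set.exists_min_image {D | R.IsReducedExpr (R.subword Q D) ω}
    (fun D => ∑ i ∈ D, (i : ℕ)) (Set.toFinite _) ⟨C, hC⟩
  refine ⟨D, hD, fun i hi => ?_⟩
  refine (R.mem_posRoots_or_neg (R.act_mem_roots _ (R.rootAt_mem_roots Q D i))).resolve_right ?_
  intro hneg
  -- A positive root at `i` would be crossed at a later `j`, and moving the letter from `j` to `i`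
  -- lowers the sum of positions. If the root is negative, its opposite is already an inversion of
  -- the prefix, hence of `ω`.
  rcases R.mem_posRoots_or_neg (R.rootAt_mem_roots Q D i) with hp | hn
  · obtain ⟨j, hj, hij, -, he⟩ := R.exists_crossing Q D (β := R.rootAt Q D i) (a := i) (b := m)
      i.2.le le_rfl (by
        rw [act_inv_pre_rootAt]
        exact R.simple_mem_posRoots (Q i).2) (by rwa [IsReducedExpr.pre_last hD])
    have hlt : i < j := lt_of_le_of_ne hij (fun h => hi (h ▸ hj))
    have hle := hmin _ (IsReducedExpr.flip hD hlt (by tauto) (Or.inl he.symm))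
    have hset : symmDiff D {i, j} = insert i (D.erase j) := by
      ext k
      simp only [Finset.mem_symmDiff, Finset.mem_insert, Finset.mem_singleton, Finset.mem_erase]
      grind
    have hsum := Finset.sum_erase_add D (fun i : Fin m => (i : ℕ)) hj
    rw [hset, Finset.sum_insert (fun h => hi (Finset.mem_of_mem_erase h))] at hle
    have : (i : ℕ) < j := hlt
    omega
  · have h := IsReducedExpr.neg_mono hD hn (a := i) (b := m) i.2.le le_rfl (by
      rw [act_neg, neg_neg, act_inv_pre_rootAt]
      exact R.simple_mem_posRoots (Q i).2)
    rw [IsReducedExpr.pre_last hD, act_neg, neg_neg] at h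
    exact R.neg_notMem_posRoots h hneg

/-! ### Translation to facets, convexity and lower sets -/

theorem mem_facets_iff {I : Finset (Fin m)} :
    I ∈ R.facets Q ω ↔ R.IsReducedExpr (R.subword Q Iᶜ) ω := Iff.rfl

theorem mem_allLinearExtensions_iff : π ∈ R.allLinearExtensions Q ω ↔
    ∃ C : Finset (Fin m), R.IsReducedExpr (R.subword Q C) ω ∧ R.Compatible Q C π := by
  simp only [allLinearExtensions, Set.mem_iUnion, mem_linearExtensions_iff, mem_facets_iff,
    exists_prop]
  constructor
  · rintro ⟨I, hI, h⟩
    exact ⟨Iᶜ, hI, h⟩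
  · rintro ⟨C, hC, h⟩
    exact ⟨Cᶜ, by rwa [compl_compl], by rwa [compl_compl]⟩

/-- For each root of the configuration, the upper end `ρ` controls the case of a positive root and
the lower end `σ` that of a negative one. -/
theorem isWeakOrderConvex_linearExtensions (I : Finset (Fin m)) :
    R.IsWeakOrderConvex (R.linearExtensions Q I) := by
  intro σ τ ρ hστ hτρ hσ hρ
  rw [mem_linearExtensions_iff] at hσ hρ ⊢
  intro k hk
  have hroot := R.rootAt_mem_roots Q Iᶜ k
  rcases R.mem_posRoots_or_neg hroot with hp | hn
  · refine (R.mem_posRoots_or_neg (R.act_mem_roots _ hroot)).resolve_right fun h => ?_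
    exact R.neg_notMem_posRoots (hρ k hk) (WeakLE.neg_act_inv_mem R hτρ hp h)
  · have := WeakLE.neg_act_inv_mem R hστ hn (by simpa using hσ k hk)
    simpa using this

theorem isWeakLowerSet_allLinearExtensions :
    R.IsWeakLowerSet (R.allLinearExtensions Q ω) := by
  intro σ τ h hτ
  replace h := WeakLE.reflTransGen R h
  induction h using Relation.ReflTransGen.head_induction_on with
  | refl => exact hτ
  | head hc _ ih =>
    obtain ⟨C, hC, h⟩ := mem_allLinearExtensions_iff.1 ih
    exact mem_allLinearExtensions_iff.2 (compatible_of_weakCov hC hc h)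

end BasedRootSystem
end SubwordCplx

open SubwordCplx BasedRootSystem in
theorem theoremB {V : Type*} [NormedAddCommGroup V] [InnerProductSpace ℝ V]
    [FiniteDimensional ℝ V] (R : SubwordCplx.BasedRootSystem V) {m : ℕ} (Q : Fin m → R.simple)
    (ω : R.coxeterGroup) (hne : (R.subwordComplex Q ω).Nonempty) :
    (∀ I ∈ R.facets Q ω, R.IsWeakOrderConvex (R.linearExtensions Q I)) ∧
    R.IsWeakLowerSet (R.allLinearExtensions Q ω) ∧
    R.weakInterval 1 ω ⊆ R.allLinearExtensions Q ω ∧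
    (∀ I ∈ R.facets Q ω, ∀ J ∈ R.facets Q ω, I ≠ J →
      Disjoint (R.linearExtensions Q I) (R.linearExtensions Q J)) := by
  obtain ⟨-, I₀, hI₀, -⟩ := hne
  refine ⟨fun I _ => isWeakOrderConvex_linearExtensions I, isWeakLowerSet_allLinearExtensions,
    fun π hπ => ?_, fun I hI J hJ hIJ => ?_⟩
  · exact isWeakLowerSet_allLinearExtensions π ω hπ.2
      (mem_allLinearExtensions_iff.2 (exists_compatible_self hI₀))
  · rw [Set.disjoint_left]
    intro π h1 h2
    rw [mem_linearExtensions_iff] at h1 h2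
    exact hIJ (compl_injective (eq_of_compatible hI hJ h1 h2))
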